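/- Let $A$ be a Hermitian $n\times n$ complex matrix with eigenvalues $\alpha_1\ge\dots\ge\alpha_n$ (with multiplicity), and let $\rho$ be an eigenvalue of $A$ of multiplicity $l\ge 1$, so that $\alpha_j=\rho$ exactly for $i<j\le i+l$. Let $P_\rho$ be the orthogonal projection onto the eigenspace of $A$ at $\rho$ and $P_\rho^\perp=I-P_\rho$. For a Hermitian $n\times n$ matrix $E$ let $\xi_1\ge\dots\ge\xi_n$ be the eigenvalues of $A+E$, set $$C=P_\rho E P_\rho^\perp,\qquad B=P_\rho E P_\rho-C\bigl(P_\rho^\perp(A-\rho I+E)P_\rho^\perp\bigr)^\dagger C^*,$$ where $\dagger$ is the Moore–Penrose inverse, and let $\beta_1\ge\dots\ge\beta_l$ be the eigenvalues (with multiplicity) of the restriction of $B$ to the $l$-dimensional invariant subspace $\operatorname{Ran}P_\rho$. Let $\|\cdot\|$ be the operator norm. Then $$\xi_j=\alpha_j+\beta_{j-i}+O(\|B\|\,\|C\|^2),\qquad i<j\le i+l,\qquad\text{and}\qquad \|B\|\,\|C\|^2=O(\|E\|^3),$$ as $E\to0$; that is, there are constants $K,K',r>0$, depending only on $A$ and $\rho$,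 such that for every Hermitian $E$ with $\|E\|<r$ one has $|\xi_j-\alpha_j-\beta_{j-i}|\le K\|B\|\|C\|^2$ for all $i<j\le i+l$, and $\|B\|\|C\|^2\le K'\|E\|^3$. -/

import Mathlib

open scoped Matrix Matrix.Norms.L2Operator

/-! Throughout, the norm of a complex matrix is its operator norm on Euclidean space. -/

namespace HermitianPerturbation

variable {n : ℕ}

/-- The eigenvalues of a Hermitian matrix, listed with multiplicity in non-increasing order. -/
noncomputable def orderedEigenvalues {M : Matrix (Fin n) (Fin n) ℂ} (hM : M.IsHermitian) :
    Fin n → ℝ :=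
  (Matrix.isSymmetric_toEuclideanLin_iff.mpr hM).eigenvalues finrank_euclideanSpace_fin

/-- The eigenspace `{v | A v = ρ v}` as a subspace of `ℂⁿ`. -/
noncomputable abbrev eigenspaceOf (A : Matrix (Fin n) (Fin n) ℂ) (ρ : ℝ) :
    Submodule ℂ (EuclideanSpace ℂ (Fin n)) :=
  Module.End.eigenspace (Matrix.toEuclideanLin A) (ρ : ℂ)

/-- The matrix `P_ρ` of the orthogonal projection of `ℂⁿ` onto the eigenspace of `A` at `ρ`. -/
noncomputable def eigenProj (A : Matrix (Fin n) (Fin n) ℂ) (ρ : ℝ) : Matrix (Fin n) (Fin n) ℂ :=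
  Matrix.toEuclideanLin.symm
    ((eigenspaceOf A ρ).starProjection :
      EuclideanSpace ℂ (Fin n) →ₗ[ℂ] EuclideanSpace ℂ (Fin n))

/-- The matrix `P_ρ^⊥ = I - P_ρ`. -/
noncomputable def eigenProjCompl (A : Matrix (Fin n) (Fin n) ℂ) (ρ : ℝ) :
    Matrix (Fin n) (Fin n) ℂ :=
  1 - eigenProj A ρ

/-- `X` is a Moore-Penrose inverse of `M`: the four Penrose equations. -/
structure IsMoorePenroseInverse (M X : Matrix (Fin n) (Fin n) ℂ) : Prop where
  mul_mul_self : M * X * M = M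
  self_mul_mul : X * M * X = X
  left_hermitian : (M * X).IsHermitian
  right_hermitian : (X * M).IsHermitian

theorem IsMoorePenroseInverse.unique {M X Y : Matrix (Fin n) (Fin n) ℂ}
    (hX : IsMoorePenroseInverse M X) (hY : IsMoorePenroseInverse M Y) : X = Y := by
  have h1 : M * X = M * Y := by
    have e1 : (M * Y) * (M * X) = M * X := by
      rw [← Matrix.mul_assoc (M * Y) M X, hY.mul_mul_self]
    have e2 : (M * X) * (M * Y) = M * Y := by
      rw [← Matrix.mul_assoc (M * X) M Y, hX.mul_mul_self]
    have e3 := congrArg Matrix.conjTranspose e1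
    rw [Matrix.conjTranspose_mul, hX.left_hermitian.eq, hY.left_hermitian.eq, e2] at e3
    exact e3.symm
  have h2 : X * M = Y * M := by
    have e1 : (X * M) * (Y * M) = X * M := by
      rw [Matrix.mul_assoc X M, ← Matrix.mul_assoc M Y M, hY.mul_mul_self]
    have e2 : (Y * M) * (X * M) = Y * M := by
      rw [Matrix.mul_assoc Y M, ← Matrix.mul_assoc M X M, hX.mul_mul_self]
    have e3 := congrArg Matrix.conjTranspose e1
    rw [Matrix.conjTranspose_mul, hX.right_hermitian.eq, hY.right_hermitian.eq, e2] at e3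
    exact e3.symm
  calc X = X * M * X := hX.self_mul_mul.symm
    _ = Y * (M * X) := by rw [h2, Matrix.mul_assoc]
    _ = Y * M * Y := by rw [h1, Matrix.mul_assoc]
    _ = Y := hY.self_mul_mul

theorem IsMoorePenroseInverse.conjTranspose {M X : Matrix (Fin n) (Fin n) ℂ}
    (h : IsMoorePenroseInverse M X) : IsMoorePenroseInverse Mᴴ Xᴴ where
  mul_mul_self := by
    rw [← Matrix.conjTranspose_mul, ← Matrix.conjTranspose_mul, ← Matrix.mul_assoc,
      h.mul_mul_self]
  self_mul_mul := by
    rw [← Matrix.conjTranspose_mul, ← Matrix.conjTranspose_mul, ← Matrix.mul_assoc,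
      h.self_mul_mul]
  left_hermitian := by
    rw [← Matrix.conjTranspose_mul]; exact h.right_hermitian.conjTranspose
  right_hermitian := by
    rw [← Matrix.conjTranspose_mul]; exact h.left_hermitian.conjTranspose

theorem exists_isMoorePenroseInverse_of_isHermitian {M : Matrix (Fin n) (Fin n) ℂ}
    (hM : M.IsHermitian) : ∃ X, IsMoorePenroseInverse M X := by
  set φ := Unitary.conjStarAlgAut ℂ _ hM.eigenvectorUnitary with hφ
  set D : Matrix (Fin n) (Fin n) ℂ :=
    Matrix.diagonal (fun i => (hM.eigenvalues i : ℂ)) with hD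
  set D' : Matrix (Fin n) (Fin n) ℂ :=
    Matrix.diagonal (fun i => (hM.eigenvalues i : ℂ)⁻¹) with hD'
  have hMD : M = φ D := hM.spectral_theorem
  have key : ∀ z : ℂ, z * z⁻¹ * z = z := fun z => by
    by_cases hz : z = 0 <;> simp [hz]
  have key' : ∀ z : ℂ, z⁻¹ * z * z⁻¹ = z⁻¹ := fun z => by
    by_cases hz : z = 0 <;> simp [hz]
  refine ⟨φ D', ?_, ?_, ?_, ?_⟩
  · rw [hMD, ← map_mul, ← map_mul]
    simp only [hD, hD', Matrix.diagonal_mul_diagonal, key]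
  · rw [hMD, ← map_mul, ← map_mul]
    simp only [hD, hD', Matrix.diagonal_mul_diagonal, key']
  · rw [hMD, ← map_mul]
    change star (φ (D * D')) = φ (D * D')
    rw [← map_star, Matrix.star_eq_conjTranspose]
    simp [hD, hD', Matrix.diagonal_conjTranspose, Pi.star_def]
  · rw [hMD, ← map_mul]
    change star (φ (D' * D)) = φ (D' * D)
    rw [← map_star, Matrix.star_eq_conjTranspose]
    simp [hD, hD', Matrix.diagonal_conjTranspose, Pi.star_def]

open scoped ComplexOrder in
theorem exists_isMoorePenroseInverse (M : Matrix (Fin n) (Fin n) ℂ) :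
    ∃ X, IsMoorePenroseInverse M X := by
  have hH : (Mᴴ * M).IsHermitian := Matrix.isHermitian_conjTranspose_mul_self M
  obtain ⟨G, hG⟩ := exists_isMoorePenroseInverse_of_isHermitian hH
  have hGh : Gᴴ = G := by
    have h := hG.conjTranspose
    rw [hH.eq] at h
    exact h.unique hG
  have hz : M * G * (Mᴴ * M) = M := by
    rw [← sub_eq_zero, ← Matrix.conjTranspose_mul_self_eq_zero]
    have e : Mᴴ * (M * G * (Mᴴ * M) - M) = 0 := by
      have h := hG.mul_mul_self
      rw [Matrix.mul_sub, sub_eq_zero, ← Matrix.mul_assoc, ← Matrix.mul_assoc Mᴴ M G]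
      exact h
    have e' : M * G * (Mᴴ * M) - M = M * (G * (Mᴴ * M) - 1) := by
      rw [Matrix.mul_sub, Matrix.mul_one, Matrix.mul_assoc]
    have e'' : (M * G * (Mᴴ * M) - M)ᴴ = (G * (Mᴴ * M) - 1)ᴴ * Mᴴ := by
      rw [e', Matrix.conjTranspose_mul]
    rw [e'', Matrix.mul_assoc, e, Matrix.mul_zero]
  refine ⟨G * Mᴴ, ?_, ?_, ?_, ?_⟩
  · simpa only [Matrix.mul_assoc] using hz
  · have h := congrArg (· * Mᴴ) hG.self_mul_mul
    simpa only [Matrix.mul_assoc] using h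
  · rw [Matrix.IsHermitian, Matrix.conjTranspose_mul, Matrix.conjTranspose_mul,
      Matrix.conjTranspose_conjTranspose, hGh, Matrix.mul_assoc]
  · rw [Matrix.mul_assoc]
    exact hG.right_hermitian

/-- The Moore-Penrose inverse `M†`. -/
noncomputable def pinv (M : Matrix (Fin n) (Fin n) ℂ) : Matrix (Fin n) (Fin n) ℂ :=
  (exists_isMoorePenroseInverse M).choose

theorem pinv_spec (M : Matrix (Fin n) (Fin n) ℂ) : IsMoorePenroseInverse M (pinv M) :=
  (exists_isMoorePenroseInverse M).choose_spec

theorem pinv_isHermitian {M : Matrix (Fin n) (Fin n) ℂ} (hM : M.IsHermitian) :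
    (pinv M).IsHermitian := by
  have h := (pinv_spec M).conjTranspose
  rw [hM.eq] at h
  exact h.unique (pinv_spec M)

/-- `C = P_ρ E P_ρ^⊥`. -/
noncomputable def blockC (A E : Matrix (Fin n) (Fin n) ℂ) (ρ : ℝ) : Matrix (Fin n) (Fin n) ℂ :=
  eigenProj A ρ * E * eigenProjCompl A ρ

/-- `B = P_ρ E P_ρ - C (P_ρ^⊥ (A - ρ I + E) P_ρ^⊥)† C*`. -/
noncomputable def schurB (A E : Matrix (Fin n) (Fin n) ℂ) (ρ : ℝ) : Matrix (Fin n) (Fin n) ℂ :=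
  eigenProj A ρ * E * eigenProj A ρ -
    blockC A E ρ *
      pinv (eigenProjCompl A ρ * (A - (ρ : ℂ) • 1 + E) * eigenProjCompl A ρ) *
      (blockC A E ρ)ᴴ

theorem toEuclideanLin_eigenProj (A : Matrix (Fin n) (Fin n) ℂ) (ρ : ℝ) :
    Matrix.toEuclideanLin (eigenProj A ρ) =
      ((eigenspaceOf A ρ).starProjection :
        EuclideanSpace ℂ (Fin n) →ₗ[ℂ] EuclideanSpace ℂ (Fin n)) :=
  LinearEquiv.apply_symm_apply _ _

theorem eigenProj_isHermitian (A : Matrix (Fin n) (Fin n) ℂ) (ρ : ℝ) :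
    (eigenProj A ρ).IsHermitian := by
  rw [← Matrix.isSymmetric_toEuclideanLin_iff, toEuclideanLin_eigenProj]
  exact (eigenspaceOf A ρ).starProjection_isSymmetric

theorem eigenProjCompl_isHermitian (A : Matrix (Fin n) (Fin n) ℂ) (ρ : ℝ) :
    (eigenProjCompl A ρ).IsHermitian :=
  Matrix.isHermitian_one.sub (eigenProj_isHermitian A ρ)

theorem schurB_isHermitian {A E : Matrix (Fin n) (Fin n) ℂ} (hA : A.IsHermitian)
    (hE : E.IsHermitian) (ρ : ℝ) : (schurB A E ρ).IsHermitian := by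
  have sandwich : ∀ {P M : Matrix (Fin n) (Fin n) ℂ}, P.IsHermitian → M.IsHermitian →
      (P * M * P).IsHermitian := fun {P M} hP hM => by
    have h := Matrix.isHermitian_mul_mul_conjTranspose P hM
    rwa [hP.eq] at h
  have hρ : ((ρ : ℂ) • (1 : Matrix (Fin n) (Fin n) ℂ)).IsHermitian := by
    rw [Matrix.IsHermitian, Matrix.conjTranspose_smul, Matrix.conjTranspose_one]
    simp
  refine (sandwich (eigenProj_isHermitian A ρ) hE).sub ?_
  exact Matrix.isHermitian_mul_mul_conjTranspose _
    (pinv_isHermitian (sandwich (eigenProjCompl_isHermitian A ρ) ((hA.sub hρ).add hE)))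

theorem schurB_mapsTo (A E : Matrix (Fin n) (Fin n) ℂ) (ρ : ℝ) :
    ∀ v ∈ eigenspaceOf A ρ, Matrix.toEuclideanLin (schurB A E ρ) v ∈ eigenspaceOf A ρ := by
  intro v _
  obtain ⟨X, hX⟩ : ∃ X, schurB A E ρ = eigenProj A ρ * X := by
    refine ⟨E * eigenProj A ρ - E * eigenProjCompl A ρ *
      pinv (eigenProjCompl A ρ * (A - (ρ : ℂ) • 1 + E) * eigenProjCompl A ρ) *
      (blockC A E ρ)ᴴ, ?_⟩
    simp only [schurB, Matrix.mul_sub]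
    simp only [blockC, Matrix.mul_assoc]
  rw [hX, Matrix.toLpLin_mul_same, toEuclideanLin_eigenProj]
  exact Submodule.starProjection_apply_mem _ _

/-- `β_1 ≥ … ≥ β_l`: the eigenvalues, with multiplicity and in non-increasing order, of the
restriction of `B` to the `l`-dimensional space `Ran P_ρ` (which `B` maps to itself; on the
orthogonal complement of `Ran P_ρ` it vanishes). -/
noncomputable def schurEigenvalues {A E : Matrix (Fin n) (Fin n) ℂ} (hA : A.IsHermitian)
    (hE : E.IsHermitian) (ρ : ℝ) {l : ℕ} (hl : Module.finrank ℂ (eigenspaceOf A ρ) = l) :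
    Fin l → ℝ :=
  ((Matrix.isSymmetric_toEuclideanLin_iff.mpr (schurB_isHermitian hA hE ρ)).restrict_invariant
    (schurB_mapsTo A E ρ)).eigenvalues hl

end HermitianPerturbation

/-! Write `P`, `Q` for the projections onto the eigenspace at `ρ` and onto its complement, `N` for
`Q (A - ρ + E) Q`, and `δ` for the gap between `ρ` and the other eigenvalues of `A`. For small `E`
the block `N` is invertible on the range of `Q`, with inverse `X = N†` there and `‖X‖ ≤ 2/δ`. The
unipotent matrix `T = 1 - X C*` then block-diagonalizes: `T* (A - ρ + E) T = B + N`
(`schur_congruence`, `IsGapBound.congruence_eq`).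

A congruence does not preserve eigenvalues, so the distortion of the norm must be controlled. For
`y` in the eigenspace and `z` orthogonal to it, the vector `x = T (y + z)` equals `y + (z - X C*
y)`. Hence `‖x‖² = ‖y‖² + w` with `w ≤ 2‖z‖² + (8/δ²)‖C‖²‖y‖²` (`IsGapBound.norm_sq_congruence`),
while the form of `A + E - ρ` at `x` is that of `B` at `y` plus that of `N` at `z`.

To compare `ξ_j` with `ρ + t`, apply the Courant-Fischer principle to `T (U + W)`, where `U` is
spanned by eigenvectors of `B` and `W` by eigenvectors of `A` above (or below) `ρ`. The form minus
`(ρ + t)‖x‖²` contains the distortion only through `t w`. Its `‖z‖²` share is absorbed by the gap.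
Its `‖y‖²` share is at most `(8/δ²)‖C‖²|t|‖y‖²`, and `|t| ≤ 2‖B‖` for the relevant `t`. This is
where the factor `‖B‖` in the error `‖B‖‖C‖²` comes from. -/

namespace LinearMap.IsSymmetric

/-! ### Rayleigh quotients, the Courant-Fischer principle and the spectral gap -/

open Module

variable {H : Type*} [NormedAddCommGroup H] [InnerProductSpace ℂ H] [FiniteDimensional ℂ H]
  {T : H →ₗ[ℂ] H} {n : ℕ}

theorem re_inner_eq_sum (hT : T.IsSymmetric) (hn : finrank ℂ H = n) (x : H) :
    (inner ℂ (T x) x).re =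
      ∑ i, hT.eigenvalues hn i * ‖(hT.eigenvectorBasis hn).repr x i‖ ^ 2 := by
  rw [← (hT.eigenvectorBasis hn).repr.inner_map_map, PiLp.inner_apply, Complex.re_sum]
  refine Finset.sum_congr rfl fun i _ => ?_
  rw [hT.eigenvectorBasis_apply_self_apply hn]
  simp only [RCLike.inner_apply, map_mul, Complex.coe_algebraMap, Complex.conj_ofReal]
  rw [mul_left_comm, Complex.mul_conj, Complex.normSq_eq_norm_sq]
  norm_cast

theorem sum_norm_repr_sq (hT : T.IsSymmetric) (hn : finrank ℂ H = n) (x : H) :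
    ∑ i, ‖(hT.eigenvectorBasis hn).repr x i‖ ^ 2 = ‖x‖ ^ 2 := by
  rw [← (hT.eigenvectorBasis hn).repr.norm_map, EuclideanSpace.norm_sq_eq]

/-- The span of the eigenvectors whose indices lie in `s`. -/
noncomputable def eigenSpan (hT : T.IsSymmetric) (hn : finrank ℂ H = n) (s : Finset (Fin n)) :
    Submodule ℂ H :=
  Submodule.span ℂ (Set.range fun i : s => hT.eigenvectorBasis hn i)

theorem finrank_eigenSpan (hT : T.IsSymmetric) (hn : finrank ℂ H = n) (s : Finset (Fin n)) :
    finrank ℂ (hT.eigenSpan hn s) = s.card := by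
  rw [eigenSpan, finrank_span_eq_card, Fintype.card_coe]
  exact (hT.eigenvectorBasis hn).orthonormal.linearIndependent.comp _ Subtype.val_injective

theorem eigenSpan_le_iff (hT : T.IsSymmetric) (hn : finrank ℂ H = n) {s : Finset (Fin n)}
    {W : Submodule ℂ H} :
    hT.eigenSpan hn s ≤ W ↔ ∀ i ∈ s, hT.eigenvectorBasis hn i ∈ W := by
  rw [eigenSpan, Submodule.span_le, Set.range_subset_iff]
  simp

theorem repr_eq_zero_of_mem_eigenSpan (hT : T.IsSymmetric) (hn : finrank ℂ H = n)
    {s : Finset (Fin n)} {x : H} (hx : x ∈ hT.eigenSpan hn s) {i : Fin n} (hi : i ∉ s) :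
    (hT.eigenvectorBasis hn).repr x i = 0 := by
  have h : hT.eigenSpan hn s ≤ (ℂ ∙ hT.eigenvectorBasis hn i)ᗮ := by
    rw [eigenSpan_le_iff]
    intro j hj
    rw [Submodule.mem_orthogonal_singleton_iff_inner_right]
    exact (hT.eigenvectorBasis hn).orthonormal.2 fun h => hi (h ▸ hj)
  rw [OrthonormalBasis.repr_apply_apply]
  exact Submodule.mem_orthogonal_singleton_iff_inner_right.mp (h hx)

theorem le_re_inner_of_mem_eigenSpan (hT : T.IsSymmetric) (hn : finrank ℂ H = n)
    {s : Finset (Fin n)} {c : ℝ} (hc : ∀ i ∈ s, c ≤ hT.eigenvalues hn i) {x : H}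
    (hx : x ∈ hT.eigenSpan hn s) : c * ‖x‖ ^ 2 ≤ (inner ℂ (T x) x).re := by
  rw [re_inner_eq_sum hT hn, ← hT.sum_norm_repr_sq hn, Finset.mul_sum]
  refine Finset.sum_le_sum fun i _ => ?_
  by_cases hi : i ∈ s
  · exact mul_le_mul_of_nonneg_right (hc i hi) (by positivity)
  · simp [hT.repr_eq_zero_of_mem_eigenSpan hn hx hi]

theorem re_inner_le_of_mem_eigenSpan (hT : T.IsSymmetric) (hn : finrank ℂ H = n)
    {s : Finset (Fin n)} {c : ℝ} (hc : ∀ i ∈ s, hT.eigenvalues hn i ≤ c) {x : H}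
    (hx : x ∈ hT.eigenSpan hn s) : (inner ℂ (T x) x).re ≤ c * ‖x‖ ^ 2 := by
  rw [re_inner_eq_sum hT hn, ← hT.sum_norm_repr_sq hn, Finset.mul_sum]
  refine Finset.sum_le_sum fun i _ => ?_
  by_cases hi : i ∈ s
  · exact mul_le_mul_of_nonneg_right (hc i hi) (by positivity)
  · simp [hT.repr_eq_zero_of_mem_eigenSpan hn hx hi]

theorem exists_ne_zero_mem_inf {U W : Submodule ℂ H}
    (h : finrank ℂ H < finrank ℂ U + finrank ℂ W) : ∃ x ∈ U, x ∈ W ∧ x ≠ 0 := by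
  have h1 := Submodule.finrank_sup_add_finrank_inf_eq U W
  have h2 := Submodule.finrank_le (U ⊔ W)
  have h3 : U ⊓ W ≠ ⊥ := by
    intro h0
    rw [h0, finrank_bot] at h1
    omega
  obtain ⟨x, hx, hx0⟩ := Submodule.exists_mem_ne_zero_of_ne_bot h3
  exact ⟨x, hx.1, hx.2, hx0⟩

/-- Lower half of the Courant-Fischer principle. -/
theorem le_eigenvalues_of_forall_mem (hT : T.IsSymmetric) (hn : finrank ℂ H = n) (j : Fin n)
    {c : ℝ} (S : Submodule ℂ H) (hS : (j : ℕ) + 1 ≤ finrank ℂ S)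
    (h : ∀ x ∈ S, c * ‖x‖ ^ 2 ≤ (inner ℂ (T x) x).re) : c ≤ hT.eigenvalues hn j := by
  -- The eigenvectors with index at least `j` span dimension `n - j`, so this span meets any space
  -- of dimension at least `j + 1` nontrivially.
  obtain ⟨x, hxS, hx, hx0⟩ := exists_ne_zero_mem_inf (U := S) (W := hT.eigenSpan hn (.Ici j)) (by
    rw [finrank_eigenSpan, Fin.card_Ici]; omega)
  have h1 := hT.re_inner_le_of_mem_eigenSpan hn (c := hT.eigenvalues hn j)
    (fun i hi => hT.eigenvalues_antitone hn (Finset.mem_Ici.mp hi)) hx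
  exact le_of_mul_le_mul_right ((h x hxS).trans h1) (by positivity)

/-- Upper half of the Courant-Fischer principle. -/
theorem eigenvalues_le_of_forall_mem (hT : T.IsSymmetric) (hn : finrank ℂ H = n) (j : Fin n)
    {c : ℝ} (S : Submodule ℂ H) (hS : n ≤ (j : ℕ) + finrank ℂ S)
    (h : ∀ x ∈ S, (inner ℂ (T x) x).re ≤ c * ‖x‖ ^ 2) : hT.eigenvalues hn j ≤ c := by
  obtain ⟨x, hxS, hx, hx0⟩ := exists_ne_zero_mem_inf (U := S) (W := hT.eigenSpan hn (.Iic j)) (by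
    rw [finrank_eigenSpan, Fin.card_Iic]; omega)
  have h1 := hT.le_re_inner_of_mem_eigenSpan hn (c := hT.eigenvalues hn j)
    (fun i hi => hT.eigenvalues_antitone hn (Finset.mem_Iic.mp hi)) hx
  exact le_of_mul_le_mul_right (h1.trans (h x hxS)) (by positivity)

theorem abs_eigenvalues_le (hT : T.IsSymmetric) (hn : finrank ℂ H = n) {b : ℝ}
    (hb : ∀ x, ‖T x‖ ≤ b * ‖x‖) (i : Fin n) : |hT.eigenvalues hn i| ≤ b := by
  have h := hb (hT.eigenvectorBasis hn i)
  rw [hT.apply_eigenvectorBasis hn, norm_smul, (hT.eigenvectorBasis hn).norm_eq_one] at h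
  simpa using h

theorem eigenvectorBasis_mem_orthogonal_eigenspace (hT : T.IsSymmetric) (hn : finrank ℂ H = n)
    {ρ : ℝ} {i : Fin n} (hi : hT.eigenvalues hn i ≠ ρ) :
    hT.eigenvectorBasis hn i ∈ (End.eigenspace T (ρ : ℂ))ᗮ := by
  rw [Submodule.mem_orthogonal]
  intro u hu
  have h := hT.orthogonalFamily_eigenspaces (i := (ρ : ℂ)) (j := (hT.eigenvalues hn i : ℂ))
    (by exact_mod_cast hi.symm)
  exact h ⟨u, hu⟩ ⟨_, (hT.hasEigenvector_eigenvectorBasis hn i).1⟩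

/-- On the orthogonal complement of an eigenspace, `T - ρ` is bounded below by the spectral gap. -/
theorem gap_mul_norm_le (hT : T.IsSymmetric) (hn : finrank ℂ H = n) {ρ δ : ℝ} (hδ : 0 ≤ δ)
    (hgap : ∀ i, hT.eigenvalues hn i ≠ ρ → δ ≤ |hT.eigenvalues hn i - ρ|) {z : H}
    (hz : z ∈ (End.eigenspace T (ρ : ℂ))ᗮ) : δ * ‖z‖ ≤ ‖T z - (ρ : ℂ) • z‖ := by
  refine le_of_sq_le_sq ?_ (norm_nonneg _)
  rw [mul_pow, ← hT.sum_norm_repr_sq hn, ← hT.sum_norm_repr_sq hn, Finset.mul_sum]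
  refine Finset.sum_le_sum fun i _ => ?_
  rw [map_sub, map_smul, PiLp.sub_apply, PiLp.smul_apply, hT.eigenvectorBasis_apply_self_apply hn,
    smul_eq_mul, ← sub_mul, norm_mul, mul_pow]
  by_cases hi : hT.eigenvalues hn i = ρ
  · have h0 : (hT.eigenvectorBasis hn).repr z i = 0 := by
      rw [OrthonormalBasis.repr_apply_apply]
      refine (Submodule.mem_orthogonal _ _).mp hz _ ?_
      rw [← hi]
      exact (hT.hasEigenvector_eigenvectorBasis hn i).1
    simp [h0]
  · refine mul_le_mul_of_nonneg_right (pow_le_pow_left₀ hδ ?_ 2) (by positivity)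
    have h := hgap i hi
    rwa [← Real.norm_eq_abs, ← Complex.norm_real, Complex.ofReal_sub] at h

end LinearMap.IsSymmetric

theorem exists_pos_le_abs_sub {ι : Type*} [Finite ι] (f : ι → ℝ) (c : ℝ) :
    ∃ δ > 0, ∀ i, f i ≠ c → δ ≤ |f i - c| := by
  cases nonempty_fintype ι
  by_cases h : ((Finset.univ.filter fun i => f i ≠ c).image fun i => |f i - c|).Nonempty
  · refine ⟨Finset.min' _ h, ?_, fun i hi => Finset.min'_le _ _ (Finset.mem_image.mpr
      ⟨i, Finset.mem_filter.mpr ⟨Finset.mem_univ i, hi⟩, rfl⟩)⟩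
    obtain ⟨i, hi, he⟩ := Finset.mem_image.mp (Finset.min'_mem _ h)
    rw [gt_iff_lt, ← he]
    exact abs_pos.mpr (sub_ne_zero.mpr (Finset.mem_filter.mp hi).2)
  -- When `f` takes no value other than `c`, any positive number serves as the gap.
  · exact ⟨1, one_pos, fun i hi => absurd ⟨_, Finset.mem_image_of_mem _
      (Finset.mem_filter.mpr ⟨Finset.mem_univ i, hi⟩)⟩ h⟩

namespace HermitianPerturbation

open Matrix

variable {n : ℕ}

/-! ### Matrices as operators, and the spectral projections -/

theorem toEuclideanLin_mul_apply (M N : Matrix (Fin n) (Fin n) ℂ) (v : EuclideanSpace ℂ (Fin n)) :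
    toEuclideanLin (M * N) v = toEuclideanLin M (toEuclideanLin N v) := by
  rw [toLpLin_mul_same]; rfl

theorem toEuclideanLin_one_apply (v : EuclideanSpace ℂ (Fin n)) :
    toEuclideanLin (1 : Matrix (Fin n) (Fin n) ℂ) v = v := by
  simp

theorem inner_toEuclideanLin_left (M : Matrix (Fin n) (Fin n) ℂ)
    (v w : EuclideanSpace ℂ (Fin n)) :
    inner ℂ (toEuclideanLin M v) w = inner ℂ v (toEuclideanLin Mᴴ w) := by
  rw [toEuclideanLin_conjTranspose_eq_adjoint, LinearMap.adjoint_inner_right]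

theorem norm_toEuclideanLin_le (M : Matrix (Fin n) (Fin n) ℂ) (v : EuclideanSpace ℂ (Fin n)) :
    ‖toEuclideanLin M v‖ ≤ ‖M‖ * ‖v‖ :=
  l2_opNorm_mulVec M v

theorem norm_le_of_forall_toEuclideanLin {M : Matrix (Fin n) (Fin n) ℂ} {c : ℝ} (hc : 0 ≤ c)
    (h : ∀ v, ‖toEuclideanLin M v‖ ≤ c * ‖v‖) : ‖M‖ ≤ c := by
  rw [← l2_opNorm_toEuclideanCLM]
  exact ContinuousLinearMap.opNorm_le_bound _ hc h

theorem matrix_ext_toEuclideanLin {M N : Matrix (Fin n) (Fin n) ℂ}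
    (h : ∀ v, toEuclideanLin M v = toEuclideanLin N v) : M = N :=
  toEuclideanLin.injective (LinearMap.ext h)

section Projections

variable (A : Matrix (Fin n) (Fin n) ℂ) (ρ : ℝ)

theorem toEuclideanLin_eigenProj_apply (v : EuclideanSpace ℂ (Fin n)) :
    toEuclideanLin (eigenProj A ρ) v = (eigenspaceOf A ρ).starProjection v := by
  rw [toEuclideanLin_eigenProj]; rfl

theorem toEuclideanLin_eigenProjCompl_apply (v : EuclideanSpace ℂ (Fin n)) :
    toEuclideanLin (eigenProjCompl A ρ) v = v - (eigenspaceOf A ρ).starProjection v := by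
  rw [eigenProjCompl, map_sub, LinearMap.sub_apply, toEuclideanLin_one_apply,
    toEuclideanLin_eigenProj_apply]

theorem toEuclideanLin_eigenProjCompl_mem (v : EuclideanSpace ℂ (Fin n)) :
    toEuclideanLin (eigenProjCompl A ρ) v ∈ (eigenspaceOf A ρ)ᗮ := by
  rw [toEuclideanLin_eigenProjCompl_apply]
  exact Submodule.sub_starProjection_mem_orthogonal v

theorem norm_eigenProj_le : ‖eigenProj A ρ‖ ≤ 1 :=
  norm_le_of_forall_toEuclideanLin zero_le_one fun v => by
    rw [toEuclideanLin_eigenProj_apply, one_mul]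
    exact Submodule.norm_starProjection_apply_le _ v

theorem norm_eigenProjCompl_le : ‖eigenProjCompl A ρ‖ ≤ 1 :=
  norm_le_of_forall_toEuclideanLin zero_le_one fun v => by
    rw [toEuclideanLin_eigenProjCompl_apply, one_mul, ← Submodule.starProjection_orthogonal_val]
    exact Submodule.norm_starProjection_apply_le _ v

theorem eigenProj_mul_self : eigenProj A ρ * eigenProj A ρ = eigenProj A ρ :=
  matrix_ext_toEuclideanLin fun v => by
    rw [toEuclideanLin_mul_apply, toEuclideanLin_eigenProj_apply, toEuclideanLin_eigenProj_apply]
    exact Submodule.starProjection_eq_self_iff.mpr (Submodule.starProjection_apply_mem _ _)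

theorem sub_smul_mul_eigenProj : (A - (ρ : ℂ) • 1) * eigenProj A ρ = 0 :=
  matrix_ext_toEuclideanLin fun v => by
    have h : (eigenspaceOf A ρ).starProjection v ∈ eigenspaceOf A ρ :=
      Submodule.starProjection_apply_mem _ _
    rw [toEuclideanLin_mul_apply, toEuclideanLin_eigenProj_apply, map_sub, map_smul,
      LinearMap.sub_apply, LinearMap.smul_apply, toEuclideanLin_one_apply,
      Module.End.mem_eigenspace_iff.mp h, sub_self, map_zero, LinearMap.zero_apply]

end Projections

theorem sub_smul_isHermitian {A : Matrix (Fin n) (Fin n) ℂ} (hA : A.IsHermitian) (ρ : ℝ) :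
    (A - (ρ : ℂ) • 1).IsHermitian := by
  refine hA.sub ?_
  rw [IsHermitian, conjTranspose_smul, conjTranspose_one]
  simp

theorem eigenProj_mul_sub_smul {A : Matrix (Fin n) (Fin n) ℂ} (hA : A.IsHermitian) (ρ : ℝ) :
    eigenProj A ρ * (A - (ρ : ℂ) • 1) = 0 := by
  have h := congrArg conjTranspose (sub_smul_mul_eigenProj A ρ)
  rwa [conjTranspose_mul, (sub_smul_isHermitian hA ρ).eq, (eigenProj_isHermitian A ρ).eq,
    conjTranspose_zero] at h

/-! ### Schur complement and the inverse of a compressed block -/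

/-- Block diagonalization by congruence with the unipotent matrix `1 - X C*`. -/
theorem schur_congruence {R : Type*} [Ring R] {P A₀ E X : R} (hP : P * P = P)
    (hPA : P * A₀ = 0) (hAP : A₀ * P = 0) (hPX : P * X = 0)
    (hNX : (1 - P) * (A₀ + E) * (1 - P) * X = 1 - P)
    (hXN : X * ((1 - P) * (A₀ + E) * (1 - P)) = 1 - P) :
    (1 - P * E * (1 - P) * X) * (A₀ + E) * (1 - X * ((1 - P) * E * P)) =
      (P * E * P - P * E * (1 - P) * X * ((1 - P) * E * P)) +
        (1 - P) * (A₀ + E) * (1 - P) := by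
  set Q := 1 - P with hQ
  have hPQ : P * Q = 0 := by rw [hQ, mul_sub, mul_one, hP, sub_self]
  have hQP : Q * P = 0 := by rw [hQ, sub_mul, one_mul, hP, sub_self]
  have hQX : Q * X = X := by rw [hQ, sub_mul, one_mul, hPX, sub_zero]
  have hQQ : Q * Q = Q := by rw [hQ, mul_sub, mul_one, ← hQ, hQP, sub_zero]
  set N := Q * (A₀ + E) * Q with hN
  -- `A₀` is annihilated by `P` on both sides, so it contributes only to the `Q`-`Q` block.
  have hM : A₀ + E = P * E * P + P * E * Q + Q * E * P + N := by
    have e : P * (A₀ + E) = P * E := by rw [mul_add, hPA, zero_add]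
    have e' : (A₀ + E) * P = E * P := by rw [add_mul, hAP, zero_add]
    have s : P + Q = 1 := by rw [hQ]; abel
    calc A₀ + E = (P + Q) * (A₀ + E) * (P + Q) := by rw [s, one_mul, mul_one]
      _ = P * (A₀ + E) * P + P * (A₀ + E) * Q + Q * ((A₀ + E) * P) + Q * (A₀ + E) * Q := by
        noncomm_ring
      _ = _ := by rw [e, e', hN, mul_assoc Q E P]
  -- Only `P * X = 0` is assumed; evaluating `X * N * X` in two ways gives the vanishing on the
  -- other side.
  have hXP : X * P = 0 := by
    have hh : X * Q = X * N * X := by rw [mul_assoc, hNX]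
    rw [hXN, hQX, hQ, mul_sub, mul_one] at hh
    exact sub_eq_self.mp hh
  have hNC : N * X * (Q * E * P) = Q * E * P := by
    rw [hNX, ← mul_assoc, ← mul_assoc, hQQ]
  -- The right factor clears the block `Q * E * P`; the left factor then removes `P * E * Q`, which
  -- is `h2`.
  have hML : (A₀ + E) * (1 - X * (Q * E * P)) =
      P * E * P - P * E * Q * X * (Q * E * P) + P * E * Q + N := by
    have h1 : (A₀ + E) * X = P * E * Q * X + N * X := by
      rw [hM, add_mul, add_mul, add_mul, mul_assoc (P * E) P, mul_assoc (Q * E) P, hPX]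
      simp
    rw [mul_sub, mul_one, ← mul_assoc, h1, add_mul, hNC, hM]
    abel
  rw [mul_assoc, hML, sub_mul, one_mul]
  have h2 : P * E * Q * X *
      (P * E * P - P * E * Q * X * (Q * E * P) + P * E * Q + N) = P * E * Q := by
    have h3 : X * (P * E * P - P * E * Q * X * (Q * E * P) + P * E * Q + N) =
        X * P * (E * P - E * Q * X * (Q * E * P) + E * Q) + X * N := by noncomm_ring
    rw [mul_assoc (P * E * Q), h3, hXP, hXN, zero_mul, zero_add, mul_assoc, hQQ]
  rw [h2]
  abel

/-- If a Hermitian matrix supported on the range of the projection `Q` is injective there, its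
Moore-Penrose inverse is the inverse on that range. -/
theorem pinv_eq_inverse_on_range {Q N : Matrix (Fin n) (Fin n) ℂ} (hQ : Q.IsHermitian)
    (hN : N.IsHermitian) (hNQ : N * Q = N) (hinj : ∀ Y, N * Y = 0 → Q * Y = 0) :
    pinv N * N = Q ∧ N * pinv N = Q ∧ Q * pinv N = pinv N := by
  obtain ⟨h1, h2, h3, h4⟩ := pinv_spec N
  have hX := pinv_isHermitian hN
  have hQN : Q * N = N := by
    have h := congrArg conjTranspose hNQ
    rwa [conjTranspose_mul, hN.eq, hQ.eq] at h
  have hXN : pinv N * N = N * pinv N := by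
    have h := h4.eq
    rw [conjTranspose_mul, hN.eq, hX.eq] at h
    exact h.symm
  have hQX : Q * pinv N = pinv N := by
    rw [← h2, hXN, ← Matrix.mul_assoc, ← Matrix.mul_assoc, hQN]
  have hXNQ : pinv N * N = Q := by
    have h := hinj (pinv N * N - Q) (by
      rw [Matrix.mul_sub, hNQ, ← Matrix.mul_assoc, h1, sub_self])
    rw [Matrix.mul_sub, ← Matrix.mul_assoc, hQX, sub_eq_zero] at h
    -- Idempotence of `Q` is not assumed; it follows from injectivity applied to `Q - 1`.
    have hQQ : Q * Q = Q := by
      have h' := hinj (Q - 1) (by rw [Matrix.mul_sub, hNQ, Matrix.mul_one, sub_self])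
      rwa [Matrix.mul_sub, Matrix.mul_one, sub_eq_zero] at h'
    rw [h, hQQ]
  exact ⟨hXNQ, hXN ▸ hXNQ, hQX⟩

/-! ### The compressed block on the complement of the eigenspace -/

open Module

variable {A E : Matrix (Fin n) (Fin n) ℂ} {ρ δ : ℝ}

/-- The compression of `A - ρ I + E` to the orthogonal complement of the eigenspace. -/
noncomputable def complBlock (A E : Matrix (Fin n) (Fin n) ℂ) (ρ : ℝ) :
    Matrix (Fin n) (Fin n) ℂ :=
  eigenProjCompl A ρ * (A - (ρ : ℂ) • 1 + E) * eigenProjCompl A ρ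

theorem complBlock_isHermitian (hA : A.IsHermitian) (hE : E.IsHermitian) (ρ : ℝ) :
    (complBlock A E ρ).IsHermitian := by
  have h := isHermitian_mul_mul_conjTranspose (eigenProjCompl A ρ)
    ((sub_smul_isHermitian hA ρ).add hE)
  rwa [(eigenProjCompl_isHermitian A ρ).eq] at h

theorem eigenProjCompl_mul_self (A : Matrix (Fin n) (Fin n) ℂ) (ρ : ℝ) :
    eigenProjCompl A ρ * eigenProjCompl A ρ = eigenProjCompl A ρ := by
  simp only [eigenProjCompl, Matrix.mul_sub, Matrix.sub_mul, Matrix.mul_one, Matrix.one_mul,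
    eigenProj_mul_self, sub_self, sub_zero]

theorem eigenProj_mul_eigenProjCompl (A : Matrix (Fin n) (Fin n) ℂ) (ρ : ℝ) :
    eigenProj A ρ * eigenProjCompl A ρ = 0 := by
  rw [eigenProjCompl, Matrix.mul_sub, Matrix.mul_one, eigenProj_mul_self, sub_self]

theorem toEuclideanLin_eigenProj_eq_zero {z : EuclideanSpace ℂ (Fin n)}
    (hz : z ∈ (eigenspaceOf A ρ)ᗮ) : toEuclideanLin (eigenProj A ρ) z = 0 := by
  rw [toEuclideanLin_eigenProj_apply]
  exact (eigenspaceOf A ρ).starProjection_apply_eq_zero_iff.mpr hz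

theorem toEuclideanLin_eigenProjCompl_eq_self {z : EuclideanSpace ℂ (Fin n)}
    (hz : z ∈ (eigenspaceOf A ρ)ᗮ) : toEuclideanLin (eigenProjCompl A ρ) z = z := by
  rw [eigenProjCompl, map_sub, LinearMap.sub_apply, toEuclideanLin_one_apply,
    toEuclideanLin_eigenProj_eq_zero hz, sub_zero]

theorem toEuclideanLin_eigenProjCompl_eq_zero {y : EuclideanSpace ℂ (Fin n)}
    (hy : y ∈ eigenspaceOf A ρ) : toEuclideanLin (eigenProjCompl A ρ) y = 0 := by
  rw [toEuclideanLin_eigenProjCompl_apply, Submodule.starProjection_eq_self_iff.mpr hy, sub_self]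

theorem complBlock_mul_eigenProjCompl (A E : Matrix (Fin n) (Fin n) ℂ) (ρ : ℝ) :
    complBlock A E ρ * eigenProjCompl A ρ = complBlock A E ρ := by
  rw [complBlock, Matrix.mul_assoc, eigenProjCompl_mul_self]

theorem toEuclideanLin_complBlock_apply (hA : A.IsHermitian) {z : EuclideanSpace ℂ (Fin n)}
    (hz : z ∈ (eigenspaceOf A ρ)ᗮ) :
    toEuclideanLin (complBlock A E ρ) z = toEuclideanLin A z - (ρ : ℂ) • z +
      toEuclideanLin (eigenProjCompl A ρ) (toEuclideanLin E z) := by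
  have h : eigenProjCompl A ρ * (A - (ρ : ℂ) • 1 + E) =
      (A - (ρ : ℂ) • 1) + eigenProjCompl A ρ * E := by
    rw [Matrix.mul_add]
    nth_rewrite 1 [eigenProjCompl]
    rw [Matrix.sub_mul, eigenProj_mul_sub_smul hA, sub_zero, Matrix.one_mul]
  rw [complBlock, toEuclideanLin_mul_apply, toEuclideanLin_eigenProjCompl_eq_self hz, h, map_add,
    map_sub, map_smul, LinearMap.add_apply, LinearMap.sub_apply, LinearMap.smul_apply,
    toEuclideanLin_one_apply, toEuclideanLin_mul_apply]

theorem norm_eigenProjCompl_apply_le (A : Matrix (Fin n) (Fin n) ℂ) (ρ : ℝ)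
    (v : EuclideanSpace ℂ (Fin n)) : ‖toEuclideanLin (eigenProjCompl A ρ) v‖ ≤ ‖v‖ :=
  (norm_toEuclideanLin_le _ v).trans
    (mul_le_of_le_one_left (norm_nonneg v) (norm_eigenProjCompl_le A ρ))

theorem conjTranspose_blockC (A : Matrix (Fin n) (Fin n) ℂ) (hE : E.IsHermitian) (ρ : ℝ) :
    (blockC A E ρ)ᴴ = eigenProjCompl A ρ * E * eigenProj A ρ := by
  rw [blockC, conjTranspose_mul, conjTranspose_mul, hE.eq, (eigenProj_isHermitian A ρ).eq,
    (eigenProjCompl_isHermitian A ρ).eq, Matrix.mul_assoc]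

theorem norm_mul_mul_le {M N K : Matrix (Fin n) (Fin n) ℂ} {a b c : ℝ} (hM : ‖M‖ ≤ a)
    (hN : ‖N‖ ≤ b) (hK : ‖K‖ ≤ c) : ‖M * N * K‖ ≤ a * b * c := by
  have ha : 0 ≤ a := (norm_nonneg M).trans hM
  have hb : 0 ≤ b := (norm_nonneg N).trans hN
  have h1 : ‖M * N‖ ≤ a * b :=
    (l2_opNorm_mul M N).trans (mul_le_mul hM hN (norm_nonneg N) ha)
  exact (l2_opNorm_mul (M * N) K).trans (mul_le_mul h1 hK (norm_nonneg K) (mul_nonneg ha hb))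

theorem norm_blockC_le (A E : Matrix (Fin n) (Fin n) ℂ) (ρ : ℝ) : ‖blockC A E ρ‖ ≤ ‖E‖ := by
  have h := norm_mul_mul_le (norm_eigenProj_le A ρ) (le_refl ‖E‖) (norm_eigenProjCompl_le A ρ)
  rwa [one_mul, mul_one] at h

theorem schurB_eq (A E : Matrix (Fin n) (Fin n) ℂ) (ρ : ℝ) :
    schurB A E ρ = eigenProj A ρ * E * eigenProj A ρ -
      blockC A E ρ * pinv (complBlock A E ρ) * (blockC A E ρ)ᴴ := rfl

/-! ### Bounds and congruence for a perturbation small relative to the gap -/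

/-- `δ` is at most the distance from `ρ` to the other eigenvalues of `A`, and `E` is small in
comparison with `δ`. -/
structure IsGapBound (hA : A.IsHermitian) (E : Matrix (Fin n) (Fin n) ℂ) (ρ δ : ℝ) : Prop where
  pos : 0 < δ
  gap : ∀ i, orderedEigenvalues hA i ≠ ρ → δ ≤ |orderedEigenvalues hA i - ρ|
  small : ‖E‖ ≤ δ / 2

namespace IsGapBound

variable {hA : A.IsHermitian}

/-- The gap gives `A - ρ` the lower bound `δ`, and the compressed perturbation costs at most `δ / 2`
of it. -/
theorem le_norm_complBlock_apply (h : IsGapBound hA E ρ δ) {z : EuclideanSpace ℂ (Fin n)}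
    (hz : z ∈ (eigenspaceOf A ρ)ᗮ) : δ / 2 * ‖z‖ ≤ ‖toEuclideanLin (complBlock A E ρ) z‖ := by
  have h1 := (isSymmetric_toEuclideanLin_iff.mpr hA).gap_mul_norm_le finrank_euclideanSpace_fin
    h.pos.le h.gap hz
  have h2 : ‖toEuclideanLin (eigenProjCompl A ρ) (toEuclideanLin E z)‖ ≤ δ / 2 * ‖z‖ :=
    (norm_eigenProjCompl_apply_le A ρ _).trans
      ((norm_toEuclideanLin_le E z).trans (by gcongr; exact h.small))
  rw [toEuclideanLin_complBlock_apply hA hz]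
  have h3 := norm_sub_le_norm_add (toEuclideanLin A z - (ρ : ℂ) • z)
    (toEuclideanLin (eigenProjCompl A ρ) (toEuclideanLin E z))
  linarith

theorem pinv_complBlock (h : IsGapBound hA E ρ δ) (hE : E.IsHermitian) :
    pinv (complBlock A E ρ) * complBlock A E ρ = eigenProjCompl A ρ ∧
      complBlock A E ρ * pinv (complBlock A E ρ) = eigenProjCompl A ρ ∧
      eigenProjCompl A ρ * pinv (complBlock A E ρ) = pinv (complBlock A E ρ) := by
  refine pinv_eq_inverse_on_range (eigenProjCompl_isHermitian A ρ)
    (complBlock_isHermitian hA hE ρ) (complBlock_mul_eigenProjCompl A E ρ) fun Y hY => ?_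
  refine matrix_ext_toEuclideanLin fun v => ?_
  rw [toEuclideanLin_mul_apply, map_zero, LinearMap.zero_apply, ← norm_le_zero_iff]
  have h1 := h.le_norm_complBlock_apply
    (toEuclideanLin_eigenProjCompl_mem A ρ (toEuclideanLin Y v))
  rw [← toEuclideanLin_mul_apply, ← toEuclideanLin_mul_apply, ← Matrix.mul_assoc,
    complBlock_mul_eigenProjCompl, hY, map_zero, LinearMap.zero_apply, norm_zero] at h1
  rw [← toEuclideanLin_mul_apply]
  exact le_of_mul_le_mul_left (by simpa using h1) (half_pos h.pos)

theorem norm_pinv_complBlock_le (h : IsGapBound hA E ρ δ) (hE : E.IsHermitian) :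
    ‖pinv (complBlock A E ρ)‖ ≤ 2 / δ := by
  have hδ := h.pos
  obtain ⟨-, hNX, hQX⟩ := h.pinv_complBlock hE
  refine norm_le_of_forall_toEuclideanLin (by positivity) fun v => ?_
  have h1 := h.le_norm_complBlock_apply
    (toEuclideanLin_eigenProjCompl_mem A ρ (toEuclideanLin (pinv (complBlock A E ρ)) v))
  rw [← toEuclideanLin_mul_apply, hQX, ← toEuclideanLin_mul_apply, hNX] at h1
  have h2 := h1.trans (norm_eigenProjCompl_apply_le A ρ v)
  rw [div_mul_eq_mul_div, le_div_iff₀ hδ]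
  linarith

/-- One factor `‖C‖ ≤ δ / 2` cancels `‖N†‖ ≤ 2 / δ`, so the correction term is at most `‖E‖`, like
the leading term. -/
theorem norm_schurB_le (h : IsGapBound hA E ρ δ) (hE : E.IsHermitian) :
    ‖schurB A E ρ‖ ≤ 2 * ‖E‖ := by
  have hδ := h.pos
  have hC := norm_blockC_le A E ρ
  have h1 := norm_mul_mul_le (norm_eigenProj_le A ρ) (le_refl ‖E‖) (norm_eigenProj_le A ρ)
  have h2 := norm_mul_mul_le (hC.trans h.small) (h.norm_pinv_complBlock_le hE)
    ((l2_opNorm_conjTranspose (blockC A E ρ)).trans_le hC)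
  have h3 : δ / 2 * (2 / δ) * ‖E‖ = ‖E‖ := by field_simp
  rw [one_mul, mul_one] at h1
  rw [h3] at h2
  rw [schurB_eq]
  linarith [norm_sub_le (eigenProj A ρ * E * eigenProj A ρ)
    (blockC A E ρ * pinv (complBlock A E ρ) * (blockC A E ρ)ᴴ)]

theorem eigenProj_mul_pinv_complBlock (h : IsGapBound hA E ρ δ) (hE : E.IsHermitian) :
    eigenProj A ρ * pinv (complBlock A E ρ) = 0 := by
  rw [← (h.pinv_complBlock hE).2.2, ← Matrix.mul_assoc, eigenProj_mul_eigenProjCompl,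
    Matrix.zero_mul]

theorem congruence_eq (h : IsGapBound hA E ρ δ) (hE : E.IsHermitian) :
    (1 - pinv (complBlock A E ρ) * (blockC A E ρ)ᴴ)ᴴ * (A - (ρ : ℂ) • 1 + E) *
        (1 - pinv (complBlock A E ρ) * (blockC A E ρ)ᴴ) =
      schurB A E ρ + complBlock A E ρ := by
  obtain ⟨hXN, hNX, -⟩ := h.pinv_complBlock hE
  rw [conjTranspose_sub, conjTranspose_one, conjTranspose_mul, conjTranspose_conjTranspose,
    (pinv_isHermitian (complBlock_isHermitian hA hE ρ)).eq, schurB_eq,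
    conjTranspose_blockC A hE]
  exact schur_congruence (eigenProj_mul_self A ρ) (eigenProj_mul_sub_smul hA ρ)
    (sub_smul_mul_eigenProj A ρ) (h.eigenProj_mul_pinv_complBlock hE) hNX hXN

/-- `C*` ends in `P` and `P N† = 0`, so `N† C*` squares to zero and `1 + N† C*` is the inverse.
Injectivity lets test spaces keep their dimension. -/
theorem congruence_injective (h : IsGapBound hA E ρ δ) (hE : E.IsHermitian) :
    Function.Injective
      (toEuclideanLin (1 - pinv (complBlock A E ρ) * (blockC A E ρ)ᴴ)) := by
  have hinv : (1 + pinv (complBlock A E ρ) * (blockC A E ρ)ᴴ) *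
      (1 - pinv (complBlock A E ρ) * (blockC A E ρ)ᴴ) = 1 := by
    have h0 : (blockC A E ρ)ᴴ * pinv (complBlock A E ρ) = 0 := by
      rw [conjTranspose_blockC A hE, Matrix.mul_assoc, h.eigenProj_mul_pinv_complBlock hE,
        Matrix.mul_zero]
    have h1 : pinv (complBlock A E ρ) * (blockC A E ρ)ᴴ *
        (pinv (complBlock A E ρ) * (blockC A E ρ)ᴴ) = 0 := by
      rw [Matrix.mul_assoc, ← Matrix.mul_assoc (blockC A E ρ)ᴴ, h0, Matrix.zero_mul,
        Matrix.mul_zero]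
    rw [Matrix.mul_sub, Matrix.add_mul 1 _ (_ * _), h1, Matrix.mul_one, Matrix.one_mul]
    abel
  intro v w hvw
  have h2 := congrArg (toEuclideanLin (1 + pinv (complBlock A E ρ) * (blockC A E ρ)ᴴ)) hvw
  rwa [← toEuclideanLin_mul_apply, ← toEuclideanLin_mul_apply, hinv, toEuclideanLin_one_apply,
    toEuclideanLin_one_apply] at h2

/-! ### Rayleigh quotients under the congruence, and test spaces -/

/-- The quadratic form of `A + E` on the image of `y + z` under the block-diagonalizing
congruence. -/
theorem quadratic_form_congruence (h : IsGapBound hA E ρ δ) (hE : E.IsHermitian)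
    {x y z : EuclideanSpace ℂ (Fin n)} (hy : y ∈ eigenspaceOf A ρ) (hz : z ∈ (eigenspaceOf A ρ)ᗮ)
    (hx : x = toEuclideanLin (1 - pinv (complBlock A E ρ) * (blockC A E ρ)ᴴ) (y + z)) :
    (inner ℂ (toEuclideanLin (A + E) x) x).re = ρ * ‖x‖ ^ 2 +
      (inner ℂ (toEuclideanLin (schurB A E ρ) y) y).re +
      ((inner ℂ (toEuclideanLin A z) z).re - ρ * ‖z‖ ^ 2) +
      (inner ℂ (toEuclideanLin E z) z).re := by
  have h1 : inner ℂ (toEuclideanLin (A - (ρ : ℂ) • 1 + E) x) x =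
      inner ℂ (toEuclideanLin (schurB A E ρ + complBlock A E ρ) (y + z)) (y + z) := by
    rw [← h.congruence_eq hE, Matrix.mul_assoc, toEuclideanLin_mul_apply,
      toEuclideanLin_mul_apply, inner_toEuclideanLin_left _ _ (y + z),
      conjTranspose_conjTranspose, ← hx]
  have hself : ∀ u : EuclideanSpace ℂ (Fin n),
      (inner ℂ ((ρ : ℂ) • u) u).re = ρ * ‖u‖ ^ 2 := fun u => by
    rw [inner_smul_left, Complex.conj_ofReal, Complex.re_ofReal_mul, ← RCLike.re_eq_complex_re,
      inner_self_eq_norm_sq]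
  -- The shift is split off before the congruence is used, so that `ρ` multiplies the true norm of
  -- `x`, not that of `y + z`.
  have h2 : A + E = (A - (ρ : ℂ) • 1 + E) + (ρ : ℂ) • 1 := by abel
  have hBz : toEuclideanLin (schurB A E ρ) z = 0 := by
    have e : schurB A E ρ * eigenProj A ρ = schurB A E ρ := by
      rw [schurB_eq, conjTranspose_blockC A hE, Matrix.sub_mul]
      simp only [Matrix.mul_assoc, eigenProj_mul_self]
    rw [← e, toEuclideanLin_mul_apply, toEuclideanLin_eigenProj_eq_zero hz, map_zero]
  have hNy : toEuclideanLin (complBlock A E ρ) y = 0 := by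
    rw [complBlock, toEuclideanLin_mul_apply, toEuclideanLin_eigenProjCompl_eq_zero hy, map_zero]
  have hBy := schurB_mapsTo A E ρ y hy
  have hNz : toEuclideanLin (complBlock A E ρ) z ∈ (eigenspaceOf A ρ)ᗮ := by
    rw [complBlock, Matrix.mul_assoc, toEuclideanLin_mul_apply]
    exact toEuclideanLin_eigenProjCompl_mem A ρ _
  have h3 : inner ℂ (toEuclideanLin (eigenProjCompl A ρ) (toEuclideanLin E z)) z =
      inner ℂ (toEuclideanLin E z) z := by
    rw [inner_toEuclideanLin_left, (eigenProjCompl_isHermitian A ρ).eq,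
      toEuclideanLin_eigenProjCompl_eq_self hz]
  rw [h2, map_add, LinearMap.add_apply, inner_add_left, h1, map_smul, LinearMap.smul_apply,
    toEuclideanLin_one_apply, Complex.add_re, hself, map_add toEuclideanLin,
    LinearMap.add_apply, map_add, map_add, hBz, hNy, add_zero, zero_add, inner_add_left,
    inner_add_right, inner_add_right, Submodule.inner_right_of_mem_orthogonal hBy hz,
    Submodule.inner_left_of_mem_orthogonal hy hNz,
    add_zero, zero_add, toEuclideanLin_complBlock_apply hA hz, inner_add_left, inner_sub_left, h3,
    Complex.add_re, Complex.add_re, Complex.sub_re, hself]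
  ring

/-- The image is `y + (z - g)` with `g = N† C* y` orthogonal to the eigenspace, so Pythagoras
applies with `w = ‖z - g‖²`. The bound uses `(a + b)² ≤ 2a² + 2b²` and `‖g‖ ≤ (2/δ)‖C‖‖y‖`. -/
theorem norm_sq_congruence (h : IsGapBound hA E ρ δ) (hE : E.IsHermitian)
    {x y z : EuclideanSpace ℂ (Fin n)} (hy : y ∈ eigenspaceOf A ρ) (hz : z ∈ (eigenspaceOf A ρ)ᗮ)
    (hx : x = toEuclideanLin (1 - pinv (complBlock A E ρ) * (blockC A E ρ)ᴴ) (y + z)) :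
    ∃ w ≥ (0 : ℝ), ‖x‖ ^ 2 = ‖y‖ ^ 2 + w ∧
      w ≤ 2 * ‖z‖ ^ 2 + 8 / δ ^ 2 * ‖blockC A E ρ‖ ^ 2 * ‖y‖ ^ 2 := by
  have hδ := h.pos
  set g := toEuclideanLin (pinv (complBlock A E ρ) * (blockC A E ρ)ᴴ) y with hg
  have hgz : toEuclideanLin (pinv (complBlock A E ρ) * (blockC A E ρ)ᴴ) z = 0 := by
    rw [conjTranspose_blockC A hE, ← Matrix.mul_assoc, toEuclideanLin_mul_apply,
      toEuclideanLin_eigenProj_eq_zero hz, map_zero]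
  have hgmem : g ∈ (eigenspaceOf A ρ)ᗮ := by
    rw [hg, ← (h.pinv_complBlock hE).2.2, Matrix.mul_assoc, toEuclideanLin_mul_apply]
    exact toEuclideanLin_eigenProjCompl_mem A ρ _
  have hx' : x = y + (z - g) := by
    rw [hx, map_sub, LinearMap.sub_apply, toEuclideanLin_one_apply, map_add, hgz, ← hg]
    abel
  have hgn : ‖g‖ ≤ 2 / δ * ‖blockC A E ρ‖ * ‖y‖ := by
    refine (norm_toEuclideanLin_le _ y).trans ?_
    gcongr
    refine (l2_opNorm_mul _ _).trans ?_
    rw [l2_opNorm_conjTranspose]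
    gcongr
    exact h.norm_pinv_complBlock_le hE
  have hg2 : ‖g‖ ^ 2 ≤ 4 / δ ^ 2 * ‖blockC A E ρ‖ ^ 2 * ‖y‖ ^ 2 :=
    (pow_le_pow_left₀ (norm_nonneg g) hgn 2).trans_eq (by ring)
  refine ⟨‖z - g‖ ^ 2, by positivity, ?_, ?_⟩
  · rw [hx', sq, sq, sq]
    exact norm_add_sq_eq_norm_sq_add_norm_sq_of_inner_eq_zero _ _
      (Submodule.inner_right_of_mem_orthogonal hy (Submodule.sub_mem _ hz hgmem))
  · have h4 : ‖z - g‖ ^ 2 ≤ (‖z‖ + ‖g‖) ^ 2 :=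
      pow_le_pow_left₀ (norm_nonneg _) (norm_sub_le z g) 2
    have h5 : 8 / δ ^ 2 * ‖blockC A E ρ‖ ^ 2 * ‖y‖ ^ 2 =
        2 * (4 / δ ^ 2 * ‖blockC A E ρ‖ ^ 2 * ‖y‖ ^ 2) := by ring
    rw [h5]
    nlinarith [sq_nonneg (‖z‖ - ‖g‖)]

/-- A test space for the Courant-Fischer principle built from a space of approximate eigenvectors
at `ρ` and a space orthogonal to the eigenspace. -/
theorem exists_test_space (h : IsGapBound hA E ρ δ) (hE : E.IsHermitian)
    {U W : Submodule ℂ (EuclideanSpace ℂ (Fin n))} (hU : U ≤ eigenspaceOf A ρ)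
    (hW : W ≤ (eigenspaceOf A ρ)ᗮ) :
    ∃ S : Submodule ℂ (EuclideanSpace ℂ (Fin n)), finrank ℂ S = finrank ℂ U + finrank ℂ W ∧
      ∀ x ∈ S, ∃ y ∈ U, ∃ z ∈ W,
        (∃ w ≥ (0 : ℝ), ‖x‖ ^ 2 = ‖y‖ ^ 2 + w ∧
          w ≤ 2 * ‖z‖ ^ 2 + 8 / δ ^ 2 * ‖blockC A E ρ‖ ^ 2 * ‖y‖ ^ 2) ∧
        (inner ℂ (toEuclideanLin (A + E) x) x).re = ρ * ‖x‖ ^ 2 +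
          (inner ℂ (toEuclideanLin (schurB A E ρ) y) y).re +
          ((inner ℂ (toEuclideanLin A z) z).re - ρ * ‖z‖ ^ 2) +
          (inner ℂ (toEuclideanLin E z) z).re := by
  refine ⟨(U ⊔ W).map (toEuclideanLin (1 - pinv (complBlock A E ρ) * (blockC A E ρ)ᴴ)), ?_, ?_⟩
  · rw [← (Submodule.equivMapOfInjective _ (h.congruence_injective hE) (U ⊔ W)).finrank_eq,
      ← Submodule.finrank_sup_add_finrank_inf_eq,
      ((eigenspaceOf A ρ).orthogonal_disjoint.mono hU hW).eq_bot, finrank_bot, add_zero]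
  · rintro x hx
    obtain ⟨v, hv, rfl⟩ := Submodule.mem_map.mp hx
    obtain ⟨y, hy, z, hz, rfl⟩ := Submodule.mem_sup.mp hv
    exact ⟨y, hy, z, hz, h.norm_sq_congruence hE (hU hy) (hW hz) rfl,
      h.quadratic_form_congruence hE (hU hy) (hW hz) rfl⟩

theorem abs_re_inner_le (h : IsGapBound hA E ρ δ) (z : EuclideanSpace ℂ (Fin n)) :
    |(inner ℂ (toEuclideanLin E z) z).re| ≤ δ / 2 * ‖z‖ ^ 2 :=
  calc _ ≤ ‖inner ℂ (toEuclideanLin E z) z‖ := Complex.abs_re_le_norm _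
    _ ≤ ‖toEuclideanLin E z‖ * ‖z‖ := norm_inner_le_norm _ _
    _ ≤ δ / 2 * ‖z‖ * ‖z‖ := by
        gcongr
        exact (norm_toEuclideanLin_le E z).trans (by gcongr; exact h.small)
    _ = δ / 2 * ‖z‖ ^ 2 := by ring

/-- On the test space, the form minus `(ρ + t)‖x‖²` is at least `(β - t)‖y‖² + (δ/2)‖z‖² - |t| w`.
The assumption `hβ` pays for the `‖y‖²` share of `|t| w`, and `ht` for its share `2|t|‖z‖²`. The
sign of `t` is free. -/
theorem le_orderedEigenvalues (h : IsGapBound hA E ρ δ) (hE : E.IsHermitian) {t β : ℝ}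
    (ht : 4 * |t| ≤ δ) (hβ : 8 / δ ^ 2 * ‖blockC A E ρ‖ ^ 2 * |t| ≤ β - t)
    {U W : Submodule ℂ (EuclideanSpace ℂ (Fin n))} (hU : U ≤ eigenspaceOf A ρ)
    (hW : W ≤ (eigenspaceOf A ρ)ᗮ)
    (hUB : ∀ y ∈ U, β * ‖y‖ ^ 2 ≤ (inner ℂ (toEuclideanLin (schurB A E ρ) y) y).re)
    (hWA : ∀ z ∈ W, (ρ + δ) * ‖z‖ ^ 2 ≤ (inner ℂ (toEuclideanLin A z) z).re)
    (j : Fin n) (hj : (j : ℕ) + 1 ≤ finrank ℂ U + finrank ℂ W) :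
    ρ + t ≤ orderedEigenvalues (hA.add hE) j := by
  obtain ⟨S, hS, hS'⟩ := h.exists_test_space hE hU hW
  refine LinearMap.IsSymmetric.le_eigenvalues_of_forall_mem _ _ j S (hS ▸ hj) fun x hx => ?_
  obtain ⟨y, hy, z, hz, ⟨w, hw0, hxw, hw⟩, hform⟩ := hS' x hx
  rw [hform, hxw]
  have h1 := hUB y hy
  have h2 := hWA z hz
  have h3 := (abs_le.mp (h.abs_re_inner_le z)).1
  have h4 : t * w ≤ |t| * (2 * ‖z‖ ^ 2 + 8 / δ ^ 2 * ‖blockC A E ρ‖ ^ 2 * ‖y‖ ^ 2) :=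
    (mul_le_mul_of_nonneg_right (le_abs_self t) hw0).trans
      (mul_le_mul_of_nonneg_left hw (abs_nonneg t))
  have h5 := mul_le_mul_of_nonneg_right hβ (sq_nonneg ‖y‖)
  have h6 := mul_le_mul_of_nonneg_right ht (sq_nonneg ‖z‖)
  linarith

theorem orderedEigenvalues_le (h : IsGapBound hA E ρ δ) (hE : E.IsHermitian) {t β : ℝ}
    (ht : 4 * |t| ≤ δ) (hβ : 8 / δ ^ 2 * ‖blockC A E ρ‖ ^ 2 * |t| ≤ t - β)
    {U W : Submodule ℂ (EuclideanSpace ℂ (Fin n))} (hU : U ≤ eigenspaceOf A ρ)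
    (hW : W ≤ (eigenspaceOf A ρ)ᗮ)
    (hUB : ∀ y ∈ U, (inner ℂ (toEuclideanLin (schurB A E ρ) y) y).re ≤ β * ‖y‖ ^ 2)
    (hWA : ∀ z ∈ W, (inner ℂ (toEuclideanLin A z) z).re ≤ (ρ - δ) * ‖z‖ ^ 2)
    (j : Fin n) (hj : n ≤ (j : ℕ) + (finrank ℂ U + finrank ℂ W)) :
    orderedEigenvalues (hA.add hE) j ≤ ρ + t := by
  obtain ⟨S, hS, hS'⟩ := h.exists_test_space hE hU hW
  refine LinearMap.IsSymmetric.eigenvalues_le_of_forall_mem _ _ j S (hS ▸ hj) fun x hx => ?_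
  obtain ⟨y, hy, z, hz, ⟨w, hw0, hxw, hw⟩, hform⟩ := hS' x hx
  rw [hform, hxw]
  have h1 := hUB y hy
  have h2 := hWA z hz
  have h3 := (abs_le.mp (h.abs_re_inner_le z)).2
  have h4 : -t * w ≤ |t| * (2 * ‖z‖ ^ 2 + 8 / δ ^ 2 * ‖blockC A E ρ‖ ^ 2 * ‖y‖ ^ 2) :=
    (mul_le_mul_of_nonneg_right (neg_le_abs t) hw0).trans
      (mul_le_mul_of_nonneg_left hw (abs_nonneg t))
  have h5 := mul_le_mul_of_nonneg_right hβ (sq_nonneg ‖y‖)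
  have h6 := mul_le_mul_of_nonneg_right ht (sq_nonneg ‖z‖)
  linarith

/-! ### Spectral subspaces of `A` and of the Schur complement -/

/-- The span of the eigenvectors of `A` with eigenvalue above `ρ`. -/
theorem exists_space_above (h : IsGapBound hA E ρ δ) {i l : ℕ}
    (hi : ∀ j : Fin n, orderedEigenvalues hA j = ρ ↔ i ≤ (j : ℕ) ∧ (j : ℕ) < i + l)
    (j : Fin n) (h₁ : i ≤ (j : ℕ)) (h₂ : (j : ℕ) < i + l) :
    ∃ W : Submodule ℂ (EuclideanSpace ℂ (Fin n)), W ≤ (eigenspaceOf A ρ)ᗮ ∧ finrank ℂ W = i ∧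
      ∀ z ∈ W, (ρ + δ) * ‖z‖ ^ 2 ≤ (inner ℂ (toEuclideanLin A z) z).re := by
  have hδ := h.pos
  have hAs := isSymmetric_toEuclideanLin_iff.mpr hA
  have hgt : ∀ m ∈ Finset.univ.filter (fun m : Fin n => (m : ℕ) < i),
      ρ + δ ≤ hAs.eigenvalues finrank_euclideanSpace_fin m := by
    intro m hm
    have hm' : (m : ℕ) < i := (Finset.mem_filter.mp hm).2
    have h5 := h.gap m fun he => by have := (hi m).mp he; omega
    -- Comparison with an index whose eigenvalue is `ρ` decides the sign inside the absolute value
    -- of the gap.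
    have h6 : orderedEigenvalues hA j ≤ orderedEigenvalues hA m :=
      hAs.eigenvalues_antitone _ (Fin.le_def.mpr (by omega))
    rw [(hi j).mpr ⟨h₁, h₂⟩] at h6
    rw [abs_of_nonneg (by linarith)] at h5
    exact (show ρ + δ ≤ orderedEigenvalues hA m by linarith)
  refine ⟨_, ?_, ?_, fun z hz =>
    hAs.le_re_inner_of_mem_eigenSpan finrank_euclideanSpace_fin hgt hz⟩
  · rw [hAs.eigenSpan_le_iff]
    exact fun m hm => hAs.eigenvectorBasis_mem_orthogonal_eigenspace _
      ((lt_add_of_pos_right ρ hδ).trans_le (hgt m hm)).ne'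
  -- All `i` indices exist, because `i ≤ j < n`.
  · rw [hAs.finrank_eigenSpan, Fin.card_filter_val_lt]
    omega

/-- The span of the eigenvectors of `A` with eigenvalue below `ρ`. -/
theorem exists_space_below (h : IsGapBound hA E ρ δ) {i l : ℕ}
    (hi : ∀ j : Fin n, orderedEigenvalues hA j = ρ ↔ i ≤ (j : ℕ) ∧ (j : ℕ) < i + l)
    (j : Fin n) (h₁ : i ≤ (j : ℕ)) (h₂ : (j : ℕ) < i + l) :
    ∃ W : Submodule ℂ (EuclideanSpace ℂ (Fin n)), W ≤ (eigenspaceOf A ρ)ᗮ ∧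
      n ≤ i + l + finrank ℂ W ∧
      ∀ z ∈ W, (inner ℂ (toEuclideanLin A z) z).re ≤ (ρ - δ) * ‖z‖ ^ 2 := by
  have hδ := h.pos
  have hAs := isSymmetric_toEuclideanLin_iff.mpr hA
  have hlt : ∀ m ∈ Finset.univ.filter (fun m : Fin n => ¬ (m : ℕ) < i + l),
      hAs.eigenvalues finrank_euclideanSpace_fin m ≤ ρ - δ := by
    intro m hm
    have hm' : ¬ (m : ℕ) < i + l := (Finset.mem_filter.mp hm).2
    have h5 := h.gap m fun he => by have := (hi m).mp he; omega
    have h6 : orderedEigenvalues hA m ≤ orderedEigenvalues hA j :=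
      hAs.eigenvalues_antitone _ (Fin.le_def.mpr (by omega))
    rw [(hi j).mpr ⟨h₁, h₂⟩] at h6
    rw [abs_of_nonpos (by linarith)] at h5
    exact (show orderedEigenvalues hA m ≤ ρ - δ by linarith)
  refine ⟨_, ?_, ?_, fun z hz =>
    hAs.re_inner_le_of_mem_eigenSpan finrank_euclideanSpace_fin hlt hz⟩
  · rw [hAs.eigenSpan_le_iff]
    exact fun m hm => hAs.eigenvectorBasis_mem_orthogonal_eigenspace _
      ((hlt m hm).trans_lt (sub_lt_self ρ hδ)).ne
  · rw [hAs.finrank_eigenSpan]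
    have h7 := Finset.card_filter_add_card_filter_not (s := (Finset.univ : Finset (Fin n)))
      (fun m : Fin n => (m : ℕ) < i + l)
    rw [Fin.card_filter_val_lt, Finset.card_univ, Fintype.card_fin] at h7
    omega

end IsGapBound

/-- The span of the eigenvectors for the largest eigenvalues of the Schur complement. -/
theorem exists_space_schur_above (hA : A.IsHermitian) (hE : E.IsHermitian) {l : ℕ}
    (hl : finrank ℂ (eigenspaceOf A ρ) = l) (k : Fin l) :
    ∃ U : Submodule ℂ (EuclideanSpace ℂ (Fin n)), U ≤ eigenspaceOf A ρ ∧
      finrank ℂ U = k + 1 ∧ ∀ y ∈ U, schurEigenvalues hA hE ρ hl k * ‖y‖ ^ 2 ≤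
        (inner ℂ (toEuclideanLin (schurB A E ρ) y) y).re := by
  have hBs := (isSymmetric_toEuclideanLin_iff.mpr
    (schurB_isHermitian hA hE ρ)).restrict_invariant (schurB_mapsTo A E ρ)
  refine ⟨(hBs.eigenSpan hl (.Iic k)).map (eigenspaceOf A ρ).subtype,
    Submodule.map_subtype_le _ _, ?_, ?_⟩
  · rw [Submodule.finrank_map_subtype_eq, hBs.finrank_eigenSpan hl, Fin.card_Iic]
  · rintro y hy
    obtain ⟨u, hu, rfl⟩ := Submodule.mem_map.mp hy
    exact hBs.le_re_inner_of_mem_eigenSpan hl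
      (fun m hm => hBs.eigenvalues_antitone hl (Finset.mem_Iic.mp hm)) hu

/-- The span of the eigenvectors for the smallest eigenvalues of the Schur complement. -/
theorem exists_space_schur_below (hA : A.IsHermitian) (hE : E.IsHermitian) {l : ℕ}
    (hl : finrank ℂ (eigenspaceOf A ρ) = l) (k : Fin l) :
    ∃ U : Submodule ℂ (EuclideanSpace ℂ (Fin n)), U ≤ eigenspaceOf A ρ ∧
      finrank ℂ U = l - k ∧ ∀ y ∈ U, (inner ℂ (toEuclideanLin (schurB A E ρ) y) y).re ≤
        schurEigenvalues hA hE ρ hl k * ‖y‖ ^ 2 := by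
  have hBs := (isSymmetric_toEuclideanLin_iff.mpr
    (schurB_isHermitian hA hE ρ)).restrict_invariant (schurB_mapsTo A E ρ)
  refine ⟨(hBs.eigenSpan hl (.Ici k)).map (eigenspaceOf A ρ).subtype,
    Submodule.map_subtype_le _ _, ?_, ?_⟩
  · rw [Submodule.finrank_map_subtype_eq, hBs.finrank_eigenSpan hl, Fin.card_Ici]
  · rintro y hy
    obtain ⟨u, hu, rfl⟩ := Submodule.mem_map.mp hy
    exact hBs.re_inner_le_of_mem_eigenSpan hl
      (fun m hm => hBs.eigenvalues_antitone hl (Finset.mem_Ici.mp hm)) hu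

theorem abs_schurEigenvalues_le (hA : A.IsHermitian) (hE : E.IsHermitian) {l : ℕ}
    (hl : finrank ℂ (eigenspaceOf A ρ) = l) (k : Fin l) :
    |schurEigenvalues hA hE ρ hl k| ≤ ‖schurB A E ρ‖ :=
  ((isSymmetric_toEuclideanLin_iff.mpr (schurB_isHermitian hA hE ρ)).restrict_invariant
    (schurB_mapsTo A E ρ)).abs_eigenvalues_le hl
    (fun x => norm_toEuclideanLin_le (schurB A E ρ) x) k

/-! ### Choice of constants and conclusion -/

/-- Checks the two numerical conditions on the shift. From `c ≤ δ / 16` the error `η` is at most `b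
/ 16`, hence `|t| ≤ 2b` and `4|t| ≤ 8b ≤ δ`. The factor `2` in `|t| ≤ 2b` turns the `8` of the norm
distortion into the `16` of the final constant. -/
theorem shift_bounds {δ β b c t : ℝ} (hδ : 0 < δ) (hβ : |β| ≤ b) (hb : b ≤ δ / 8)
    (hc0 : 0 ≤ c) (hc : c ≤ δ / 16) (ht : |t - β| = 16 / δ ^ 2 * (b * c ^ 2)) :
    4 * |t| ≤ δ ∧ 8 / δ ^ 2 * c ^ 2 * |t| ≤ 16 / δ ^ 2 * (b * c ^ 2) := by
  have hb0 : 0 ≤ b := (abs_nonneg β).trans hβ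
  have h1 : 16 / δ ^ 2 * (b * c ^ 2) ≤ b :=
    calc _ ≤ 16 / δ ^ 2 * (b * (δ / 16) ^ 2) := by gcongr
      _ = b / 16 := by field_simp
      _ ≤ b := by linarith
  have h2 : |t| ≤ 2 * b := by
    have h3 := abs_add_le (t - β) β
    rw [sub_add_cancel] at h3
    linarith
  refine ⟨by linarith, ?_⟩
  calc 8 / δ ^ 2 * c ^ 2 * |t| ≤ 8 / δ ^ 2 * c ^ 2 * (2 * b) := by gcongr
    _ = _ := by ring

theorem IsGapBound.abs_orderedEigenvalues_sub_le {hA : A.IsHermitian}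
    (h : IsGapBound hA E ρ δ) (hE : E.IsHermitian)
    (hsmall : ‖E‖ ≤ δ / 16) {i l : ℕ} (hl : finrank ℂ (eigenspaceOf A ρ) = l)
    (hi : ∀ j : Fin n, orderedEigenvalues hA j = ρ ↔ i ≤ (j : ℕ) ∧ (j : ℕ) < i + l)
    (j : Fin n) (k : Fin l) (hk : (j : ℕ) = i + k) :
    |orderedEigenvalues (hA.add hE) j -
        (orderedEigenvalues hA j + schurEigenvalues hA hE ρ hl k)| ≤
      16 / δ ^ 2 * (‖schurB A E ρ‖ * ‖blockC A E ρ‖ ^ 2) := by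
  have h₁ : i ≤ (j : ℕ) := by omega
  have h₂ : (j : ℕ) < i + l := by omega
  have hbounds := fun t => shift_bounds (t := t) h.pos
    (abs_schurEigenvalues_le hA hE hl k)
    ((h.norm_schurB_le hE).trans (by linarith)) (norm_nonneg (blockC A E ρ))
    ((norm_blockC_le A E ρ).trans hsmall)
  set η := 16 / δ ^ 2 * (‖schurB A E ρ‖ * ‖blockC A E ρ‖ ^ 2)
  have hη0 : 0 ≤ η := by positivity
  have hlow : ρ + (schurEigenvalues hA hE ρ hl k - η) ≤
      orderedEigenvalues (hA.add hE) j := by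
    -- The hole is filled with `schurEigenvalues hA hE ρ hl k`, so `t` lies at distance exactly `η`
    -- from it.
    obtain ⟨q1, q2⟩ := hbounds (_ - η) (by rw [sub_sub_cancel_left, abs_neg, abs_of_nonneg hη0])
    obtain ⟨W, hW, hWr, hWA⟩ := h.exists_space_above hi j h₁ h₂
    -- Dimension count: `(k + 1) + i = j + 1`.
    obtain ⟨U, hU, hUr, hUB⟩ := exists_space_schur_above hA hE hl k
    refine h.le_orderedEigenvalues hE q1 (by rwa [sub_sub_cancel]) hU hW hUB hWA j ?_
    omega
  have hup : orderedEigenvalues (hA.add hE) j ≤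
      ρ + (schurEigenvalues hA hE ρ hl k + η) := by
    obtain ⟨q1, q2⟩ := hbounds (_ + η) (by rw [add_sub_cancel_left, abs_of_nonneg hη0])
    obtain ⟨W, hW, hWr, hWA⟩ := h.exists_space_below hi j h₁ h₂
    -- Dimension count: `j + (l - k) = i + l`, and `W` supplies at least the remaining `n - (i +
    -- l)`.
    obtain ⟨U, hU, hUr, hUB⟩ := exists_space_schur_below hA hE hl k
    refine h.orderedEigenvalues_le hE q1 (by rwa [add_sub_cancel_left]) hU hW hUB hWA j ?_
    omega
  rw [(hi j).mpr ⟨h₁, h₂⟩, abs_le]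
  constructor <;> linarith

end HermitianPerturbation

open HermitianPerturbation in
theorem theorem1p3 {n : ℕ} {A : Matrix (Fin n) (Fin n) ℂ} (hA : A.IsHermitian)
    (ρ : ℝ) (hρ : Module.End.HasEigenvalue (Matrix.toEuclideanLin A) (ρ : ℂ))
    (i l : ℕ) (hl : Module.finrank ℂ (eigenspaceOf A ρ) = l)
    (hi : ∀ j : Fin n, orderedEigenvalues hA j = ρ ↔ i ≤ (j : ℕ) ∧ (j : ℕ) < i + l) :
    ∃ K > (0 : ℝ), ∃ K' > (0 : ℝ), ∃ r > (0 : ℝ),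
      ∀ (E : Matrix (Fin n) (Fin n) ℂ) (hE : E.IsHermitian), ‖E‖ < r →
        (∀ (j : Fin n) (h₁ : i ≤ (j : ℕ)) (h₂ : (j : ℕ) < i + l),
          |orderedEigenvalues (hA.add hE) j -
              (orderedEigenvalues hA j + schurEigenvalues hA hE ρ hl ⟨(j : ℕ) - i, by omega⟩)|
            ≤ K * (‖schurB A E ρ‖ * ‖blockC A E ρ‖ ^ 2)) ∧
        ‖schurB A E ρ‖ * ‖blockC A E ρ‖ ^ 2 ≤ K' * ‖E‖ ^ 3 := by
  obtain ⟨δ, hδ, hgap⟩ := exists_pos_le_abs_sub (orderedEigenvalues hA) ρ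
  -- All constants depend on the gap alone; `K' = 2` comes from `‖B‖ ≤ 2‖E‖` and `‖C‖ ≤ ‖E‖`.
  refine ⟨16 / δ ^ 2, by positivity, 2, two_pos, δ / 16, by positivity, fun E hE hr => ?_⟩
  have h : IsGapBound hA E ρ δ := ⟨hδ, hgap, by linarith⟩
  refine ⟨fun j h₁ h₂ => h.abs_orderedEigenvalues_sub_le hE hr.le hl hi j _
    (Nat.add_sub_of_le h₁).symm, ?_⟩
  calc ‖schurB A E ρ‖ * ‖blockC A E ρ‖ ^ 2 ≤ 2 * ‖E‖ * ‖E‖ ^ 2 := by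
        gcongr
        · exact h.norm_schurB_le hE
        · exact norm_blockC_le A E ρ
    _ = 2 * ‖E‖ ^ 3 := by ring
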